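/- Let $A,B\in\mathbb{C}^{n\times n}$ be such that the pencil $zB-A$ is regular, i.e. $\det(zB-A)\not\equiv 0$. Let $S,T\in\mathbb{C}^{n\times n}$ be nonsingular matrices that bring the pencil to Weierstrass canonical form, $$TAS=\begin{bmatrix}J&0\\0&I_{n-d}\end{bmatrix},\qquad TBS=\begin{bmatrix}I_d&0\\0&N\end{bmatrix},$$ where $J=\mathrm{diag}\bigl(J_{d_1}(\lambda_1),\dots,J_{d_m}(\lambda_m)\bigr)$ is a $d\times d$ matrix in Jordan canonical form ($d_i\ge 1$, $\sum_i d_i=d$, the $\lambda_i$ not necessarily distinct) and $N$ is a nilpotent matrix in Jordan canonical form. Let $\Gamma$ be a positively oriented rectifiable simple closed curve in $\mathbb{C}$ on which $\det(zB-A)$ does not vanish, and let the blocks be ordered so that $\lambda_i$ lies inside $\Gamma$ if and only if $i\le l$. Put $s=d_1+\cdots+d_l$ and $$F_k=\frac{1}{2\pi\sqrt{-1}}\oint_\Gamma z^k(zB-A)^{-1}B\,dz,\qquad k=0,1,\dots.$$ Let $h,g$ be positive integers with $hg\ge s$, let $Y\in\mathbb{C}^{n\times h}$ be any matrix, and let $U=[F_0Y,F_1Y,\dots,F_{g-1}Y]$.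 Write $S_{(:,1:s)}$ for the matrix of the first $s$ columns of $S$ and $\mathrm{span}\{X\}$ for the span of the columns of $X$. Then: 1. the number of eigenvalues of $zB-A$ inside $\Gamma$, that is, of roots of $\det(zB-A)$ inside $\Gamma$ counted with multiplicity, is $s$; 2. $\mathrm{span}\{S_{(:,1:s)}\}$ is the generalized eigenspace of the eigenvalues inside $\Gamma$, that is, the sum, over all $\mu$ inside $\Gamma$, of the spaces $\bigcup_{k}E_k(\mu)$, where $E_0(\mu)=\{0\}$ and $E_{k+1}(\mu)=\{x : (A-\mu B)x=By \text{ for some } y\in E_k(\mu)\}$; 3. if $\mathrm{rank}(U)=s$, then $\mathrm{span}\{U\}=\mathrm{span}\{S_{(:,1:s)}\}$. -/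

import Mathlib

noncomputable section

open Polynomial

namespace ContourPencil

/-! ### Simple closed curves and contour integrals -/

/-- A rectifiable simple closed curve in the complex plane, given by an absolutely continuous
closed parametrization that is injective on `[0, 1)`.  This contains all piecewise `C¹` simple
closed curves, and every rectifiable one in its (scaled) arc length parametrization. -/
structure IsSimpleClosedCurve {p : ℂ} (γ : Path p p) : Prop where
  absCont : AbsolutelyContinuousOnInterval γ.extend 0 1
  inj : Set.InjOn γ {t | t < 1}

/-- The region enclosed by the curve: the points off the curve whose connected component in the
complement of the curve is bounded. -/
def inside {p : ℂ} (γ : Path p p) : Set ℂ :=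
  {w | w ∉ Set.range γ ∧ Bornology.IsBounded (connectedComponentIn (Set.range γ)ᶜ w)}

/-- The contour integral `∮_γ f(z) dz`, that is, the integral over `[0, 1]`
of `f(γ(t)) γ'(t)`. -/
def contourIntegral {p : ℂ} (γ : Path p p) (f : ℂ → ℂ) : ℂ :=
  ∫ᶜ z in γ, f z • ContinuousLinearMap.id ℂ ℂ

/-- The curve is positively oriented: it winds exactly once, counterclockwise, around each point
that it encloses. -/
def IsPositivelyOriented {p : ℂ} (γ : Path p p) : Prop :=
  ∀ w ∈ inside γ,
    (2 * (Real.pi : ℂ) * Complex.I)⁻¹ * contourIntegral γ (fun z => (z - w)⁻¹) = 1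

/-! ### Matrix pencils -/

/-- The pencil `z B - A` is regular: its determinant is not identically zero. -/
def IsRegularPencil {n : ℕ} (A B : Matrix (Fin n) (Fin n) ℂ) : Prop :=
  ∃ z : ℂ, (z • B - A).det ≠ 0

/-- The characteristic polynomial `det (X B - A)` of the pencil `z B - A`. -/
def pencilPoly {n : ℕ} (A B : Matrix (Fin n) (Fin n) ℂ) : ℂ[X] :=
  ((X : ℂ[X]) • B.map C - A.map C).det

open Classical in
/-- The number of eigenvalues of the (regular) pencil `z B - A` lying in `Ω`, counted with their
algebraic multiplicity, i.e. as roots of `det (z B - A)`. -/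
def eigenvalueCount {n : ℕ} (A B : Matrix (Fin n) (Fin n) ℂ) (Ω : Set ℂ) : ℕ :=
  ((pencilPoly A B).roots.filter (fun z => z ∈ Ω)).card

/-- The vectors reached by Jordan chains of length at most `k` of the pencil `z B - A` at `μ`:
only `0` for `k = 0`, and for `k + 1` all `x` with `(A - μ B) x = B y` for some `y` reached by
chains of length at most `k`. -/
def jordanChains {n : ℕ} (A B : Matrix (Fin n) (Fin n) ℂ) (μ : ℂ) :
    ℕ → Submodule ℂ (Fin n → ℂ)
  | 0 => ⊥
  | k + 1 => ((jordanChains A B μ k).map B.mulVecLin).comap (A - μ • B).mulVecLin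

/-- The generalized eigenspace of the pencil `z B - A` at `μ`. For `B = 1` it is the union of the
kernels of the powers of `A - μ`. -/
def genEigenspace {n : ℕ} (A B : Matrix (Fin n) (Fin n) ℂ) (μ : ℂ) :
    Submodule ℂ (Fin n → ℂ) :=
  ⨆ k, jordanChains A B μ k

/-! ### Weierstrass canonical form -/

/-- The `k × k` upper Jordan block with eigenvalue `μ`. -/
def jordanBlock (k : ℕ) (μ : ℂ) : Matrix (Fin k) (Fin k) ℂ :=
  Matrix.of fun i j => if i = j then μ else if (i : ℕ) + 1 = (j : ℕ) then 1 else 0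

/-- The block diagonal matrix with diagonal blocks `J_{d 0}(μ 0), J_{d 1}(μ 1), …`,
in this order. -/
def jordanMatrix {m : ℕ} (d : Fin m → ℕ) (μ : Fin m → ℂ) :
    Matrix (Fin (∑ i, d i)) (Fin (∑ i, d i)) ℂ :=
  Matrix.reindex finSigmaFinEquiv finSigmaFinEquiv
    (Matrix.blockDiagonal' fun i => jordanBlock (d i) (μ i))

/-- The `n × n` matrix with diagonal blocks `P` (upper left) and `Q` (lower right) and zeros
elsewhere. -/
def diagBlocks {a b n : ℕ} (h : a + b = n) (P : Matrix (Fin a) (Fin a) ℂ)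
    (Q : Matrix (Fin b) (Fin b) ℂ) : Matrix (Fin n) (Fin n) ℂ :=
  Matrix.reindex (finSumFinEquiv.trans (finCongr h)) (finSumFinEquiv.trans (finCongr h))
    (Matrix.fromBlocks P 0 0 Q)

/-- A Weierstrass canonical form of the pencil `z B - A`: nonsingular `S`, `T` with
`T A S = diag(J, I)` and `T B S = diag(I, N)`, where `J = diag(J_{d 0}(lam 0), …)` is in Jordan
form and `N` is nilpotent in Jordan form, i.e. made of Jordan blocks, of sizes `e j`, with
eigenvalue `0`. -/
structure WeierstrassForm {n : ℕ} (A B : Matrix (Fin n) (Fin n) ℂ) where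
  /-- number of Jordan blocks of `J` -/
  m : ℕ
  /-- sizes of the Jordan blocks of `J` -/
  d : Fin m → ℕ
  /-- eigenvalues of the Jordan blocks of `J` -/
  lam : Fin m → ℂ
  /-- number of Jordan blocks of `N` -/
  r : ℕ
  /-- sizes of the Jordan blocks of `N` -/
  e : Fin r → ℕ
  d_pos : ∀ i, 1 ≤ d i
  e_pos : ∀ j, 1 ≤ e j
  size_eq : ∑ i, d i + ∑ j, e j = n
  /-- right transformation matrix -/
  S : Matrix (Fin n) (Fin n) ℂ
  /-- left transformation matrix -/
  T : Matrix (Fin n) (Fin n) ℂ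
  isUnit_S : IsUnit S
  isUnit_T : IsUnit T
  mul_A_mul : T * A * S = diagBlocks size_eq (jordanMatrix d lam) 1
  mul_B_mul : T * B * S = diagBlocks size_eq 1 (jordanMatrix e fun _ => 0)

/-! ### The moment matrices -/

/-- `F_k = (2πi)⁻¹ ∮_γ z ^ k (z B - A)⁻¹ B dz`, integrated entrywise. -/
def moment {n : ℕ} (A B : Matrix (Fin n) (Fin n) ℂ) {p : ℂ} (γ : Path p p) (k : ℕ) :
    Matrix (Fin n) (Fin n) ℂ :=
  Matrix.of fun i j => (2 * (Real.pi : ℂ) * Complex.I)⁻¹ *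
    contourIntegral γ (fun z => z ^ k * ((z • B - A)⁻¹ * B) i j)

/-- The `n × (g h)` matrix `U = [F_0 Y, F_1 Y, …, F_{g-1} Y]`; its column `(k, j)` is the
`j`-th column of `F_k Y`. -/
def momentBlock {n h : ℕ} (A B : Matrix (Fin n) (Fin n) ℂ) {p : ℂ} (γ : Path p p)
    (Y : Matrix (Fin n) (Fin h) ℂ) (g : ℕ) : Matrix (Fin n) (Fin g × Fin h) ℂ :=
  Matrix.of fun i kj => (moment A B γ kj.1 * Y) i kj.2

/-- The span of the columns of a matrix. -/
def colSpan {n : ℕ} {ι : Type*} (M : Matrix (Fin n) ι ℂ) : Submodule ℂ (Fin n → ℂ) :=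
  Submodule.span ℂ (Set.range M.col)

/-- The span of the first `s` columns of a matrix. -/
def firstColSpan {n : ℕ} (M : Matrix (Fin n) (Fin n) ℂ) (s : ℕ) : Submodule ℂ (Fin n → ℂ) :=
  Submodule.span ℂ (M.col '' {j | (j : ℕ) < s})

end ContourPencil

end

/-!
All three assertions are read off in the coordinates `x' = S⁻¹ x` of the Weierstrass form, where
`A` and `B` become `diag(J, I)` and `diag(I, N)` and the first `s` coordinates are those of the
Jordan blocks with eigenvalue inside the curve.

*Counting.* `det T · det (X B - A) · det S` is the determinant of an upper triangular matrix with
diagonal entries `X - λ_i` (repeated `d_i` times) and `-1`; so the roots of `det (X B - A)` are the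
`λ_i` with multiplicity (`C_mul_pencilPoly_mul_C`).

*Generalized eigenspaces.* The columns of `S` in one block form a Jordan chain
(`S_col_mem_jordanChains`). Conversely, since `J_i - μ` for `λ_i ≠ μ` and `1 - μ N` are invertible,
every chain at `μ` has vanishing coordinates outside the blocks with eigenvalue `μ`
(`jordanChains_le_firstColSpan`).

*Moments.* The coordinates of `S⁻¹ (z B - A)⁻¹ B` beyond the first `s` are polynomials in `z`, or
polynomials in `(z - λ_i)⁻¹` with `λ_i` outside the curve. Multiplied by `z ^ k`, they integrate to
zero (`integral_resolvent_eq_zero`), so the columns of `F_k` lie in the span of the first `s`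
columns of `S`. That span has dimension at most `s`, hence equals the span of `U` as soon as `U` has
rank `s`.

The analytic input is that `z ^ k / (z - w) ^ j` integrates to zero for `w` outside the curve
(`contourIntegral_inv_sub_pow_eq_zero`). For `j ≠ 1` and `k = 0`, and for `j = 0`, there is a
primitive, and the fundamental theorem of calculus holds along absolutely continuous curves. The
case `j = 1` is the vanishing of the winding number in the unbounded component of the complement:
local branches of the logarithm show that it is locally constant there, and zero far away
(`contourIntegral_inv_sub_eq_zero`).
-/

namespace ContourPencil

open MeasureTheory Matrix

/-! ### Integration along an absolutely continuous closed curve -/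

theorem absolutelyContinuousOnInterval_comp {X Y : Type*} [PseudoMetricSpace X]
    [PseudoMetricSpace Y] {f : ℝ → X} {a b : ℝ} {F : X → Y} {K : NNReal} {s : Set X}
    (hF : LipschitzOnWith K F s) (hf : AbsolutelyContinuousOnInterval f a b)
    (hs : ∀ t ∈ Set.uIcc a b, f t ∈ s) :
    AbsolutelyContinuousOnInterval (F ∘ f) a b := by
  rw [absolutelyContinuousOnInterval_iff] at hf ⊢
  intro ε hε
  obtain ⟨δ, hδ, h⟩ := hf (ε / (K + 1)) (by positivity)
  refine ⟨δ, hδ, fun E hE hEδ => ?_⟩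
  calc ∑ i ∈ Finset.range E.1, dist ((F ∘ f) (E.2 i).1) ((F ∘ f) (E.2 i).2)
      ≤ ∑ i ∈ Finset.range E.1, K * dist (f (E.2 i).1) (f (E.2 i).2) :=
        Finset.sum_le_sum fun i hi =>
          hF.dist_le_mul _ (hs _ (hE.1 i hi).1) _ (hs _ (hE.1 i hi).2)
    _ = K * ∑ i ∈ Finset.range E.1, dist (f (E.2 i).1) (f (E.2 i).2) := by rw [Finset.mul_sum]
    _ ≤ K * (ε / (K + 1)) := by gcongr; exact (h E hE hEδ).le
    _ < (K + 1) * (ε / (K + 1)) := by gcongr; linarith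
    _ = ε := by field

/-- An absolutely continuous complex function is differentiable almost everywhere, and its
derivative is computed on real and imaginary parts. This reduces the fundamental theorem of
calculus to the real case. -/
theorem ae_deriv_re_im {f : ℝ → ℂ} {a b : ℝ} (hf : AbsolutelyContinuousOnInterval f a b) :
    ∀ᵐ t, t ∈ Set.uIcc a b → HasDerivAt f (deriv f t) t ∧
      deriv (fun t => (f t).re) t = (deriv f t).re ∧
      deriv (fun t => (f t).im) t = (deriv f t).im := by
  filter_upwards [hf.boundedVariationOn.ae_differentiableAt_of_mem_uIcc] with t ht htm
  have h := (ht htm).hasDerivAt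
  exact ⟨h, (Complex.reCLM.hasFDerivAt.comp_hasDerivAt t h).deriv,
    (Complex.imCLM.hasFDerivAt.comp_hasDerivAt t h).deriv⟩

theorem absolutelyContinuousOnInterval_re {f : ℝ → ℂ} {a b : ℝ}
    (hf : AbsolutelyContinuousOnInterval f a b) :
    AbsolutelyContinuousOnInterval (fun t => (f t).re) a b :=
  absolutelyContinuousOnInterval_comp (Complex.reCLM.lipschitz.lipschitzOnWith (s := Set.univ)) hf
    fun _ _ => Set.mem_univ _

theorem absolutelyContinuousOnInterval_im {f : ℝ → ℂ} {a b : ℝ}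
    (hf : AbsolutelyContinuousOnInterval f a b) :
    AbsolutelyContinuousOnInterval (fun t => (f t).im) a b :=
  absolutelyContinuousOnInterval_comp (Complex.imCLM.lipschitz.lipschitzOnWith (s := Set.univ)) hf
    fun _ _ => Set.mem_univ _

theorem intervalIntegrable_deriv_complex {f : ℝ → ℂ} {a b : ℝ}
    (hf : AbsolutelyContinuousOnInterval f a b) :
    IntervalIntegrable (deriv f) volume a b := by
  have hre := (absolutelyContinuousOnInterval_re hf).intervalIntegrable_deriv
  have him := (absolutelyContinuousOnInterval_im hf).intervalIntegrable_deriv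
  have h : IntervalIntegrable (fun t => ((deriv (fun t => (f t).re) t : ℝ) : ℂ) +
      ((deriv (fun t => (f t).im) t : ℝ) : ℂ) * Complex.I) volume a b := by
    rw [intervalIntegrable_iff] at hre him ⊢
    exact Integrable.add (Integrable.ofReal hre) ((Integrable.ofReal him).mul_const Complex.I)
  refine h.congr_ae ?_
  rw [Filter.EventuallyEq, ae_restrict_iff' measurableSet_uIoc]
  filter_upwards [ae_deriv_re_im hf] with t ht htm
  obtain ⟨-, h1, h2⟩ := ht (Set.uIoc_subset_uIcc htm)
  simp only [h1, h2]
  exact Complex.re_add_im _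

theorem integral_deriv_eq_sub_complex {f : ℝ → ℂ} {a b : ℝ}
    (hf : AbsolutelyContinuousOnInterval f a b) :
    ∫ t in a..b, deriv f t = f b - f a := by
  have hint := intervalIntegrable_deriv_complex hf
  apply Complex.ext
  · rw [Complex.sub_re, ← (absolutelyContinuousOnInterval_re hf).integral_deriv_eq_sub]
    refine (Complex.reCLM.intervalIntegral_comp_comm hint).symm.trans ?_
    refine intervalIntegral.integral_congr_ae ?_
    filter_upwards [ae_deriv_re_im hf] with t ht htm
    exact (ht (Set.uIoc_subset_uIcc htm)).2.1.symm
  · rw [Complex.sub_im, ← (absolutelyContinuousOnInterval_im hf).integral_deriv_eq_sub]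
    refine (Complex.imCLM.intervalIntegral_comp_comm hint).symm.trans ?_
    refine intervalIntegral.integral_congr_ae ?_
    filter_upwards [ae_deriv_re_im hf] with t ht htm
    exact (ht (Set.uIoc_subset_uIcc htm)).2.2.symm

variable {p : ℂ} {γ : Path p p}

theorem contourIntegral_eq (γ : Path p p) (f : ℂ → ℂ) :
    contourIntegral γ f = ∫ t in (0 : ℝ)..1, f (γ.extend t) * deriv γ.extend t := by
  rw [contourIntegral, curveIntegral_eq_intervalIntegral_deriv]
  simp

theorem extend_mem_range (γ : Path p p) (t : ℝ) : γ.extend t ∈ Set.range γ := by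
  rw [← γ.extend_range]; exact ⟨t, rfl⟩

theorem contourIntegral_congr {f g : ℂ → ℂ} (h : ∀ z ∈ Set.range γ, f z = g z) :
    contourIntegral γ f = contourIntegral γ g := by
  rw [contourIntegral_eq, contourIntegral_eq]
  congr 1
  ext t
  rw [h _ (extend_mem_range γ t)]

theorem contourIntegral_const_mul (c : ℂ) (f : ℂ → ℂ) :
    contourIntegral γ (fun z => c * f z) = c * contourIntegral γ f := by
  simp only [contourIntegral_eq, mul_assoc, intervalIntegral.integral_const_mul]

theorem intervalIntegrable_mul_deriv (hγ : AbsolutelyContinuousOnInterval γ.extend 0 1)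
    {f : ℂ → ℂ} (hf : ContinuousOn f (Set.range γ)) :
    IntervalIntegrable (fun t => f (γ.extend t) * deriv γ.extend t) volume 0 1 :=
  (intervalIntegrable_deriv_complex hγ).continuousOn_mul <|
    hf.comp γ.continuous_extend.continuousOn fun t _ => extend_mem_range γ t

theorem contourIntegral_add (hγ : AbsolutelyContinuousOnInterval γ.extend 0 1)
    {f g : ℂ → ℂ} (hf : ContinuousOn f (Set.range γ)) (hg : ContinuousOn g (Set.range γ)) :
    contourIntegral γ (fun z => f z + g z) = contourIntegral γ f + contourIntegral γ g := by
  simp only [contourIntegral_eq, add_mul]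
  exact intervalIntegral.integral_add (intervalIntegrable_mul_deriv hγ hf)
    (intervalIntegrable_mul_deriv hγ hg)

/-- A function with a primitive that is analytic near the curve has integral zero: the primitive
is Lipschitz on the curve, so its composition with the parametrization is again absolutely
continuous and the fundamental theorem of calculus applies to it. -/
theorem contourIntegral_eq_zero_of_primitive
    (hγ : AbsolutelyContinuousOnInterval γ.extend 0 1) {F f : ℂ → ℂ}
    (hF : ∀ z ∈ Set.range γ, AnalyticAt ℂ F z) (hf : ∀ z ∈ Set.range γ, HasDerivAt F (f z) z) :
    contourIntegral γ f = 0 := by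
  have hloc : LocallyLipschitzOn (Set.range γ) F := fun z hz => by
    obtain ⟨K, t, ht, h⟩ := ((hF z hz).contDiffAt (n := 1)).exists_lipschitzOnWith
    exact ⟨K, t, mem_nhdsWithin_of_mem_nhds ht, h⟩
  obtain ⟨K, hK⟩ := hloc.exists_lipschitzOnWith_of_compact (isCompact_range γ.continuous)
  have hac := absolutelyContinuousOnInterval_comp hK hγ fun t _ => extend_mem_range γ t
  have h := integral_deriv_eq_sub_complex hac
  rw [Function.comp_apply, Function.comp_apply, γ.extend_one, γ.extend_zero, sub_self] at h
  rw [contourIntegral_eq, ← h]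
  refine intervalIntegral.integral_congr_ae ?_
  filter_upwards [ae_deriv_re_im hγ] with t ht htm
  exact ((hf _ (extend_mem_range γ t)).comp t (ht (Set.uIoc_subset_uIcc htm)).1).deriv.symm

theorem contourIntegral_pow_eq_zero (hγ : AbsolutelyContinuousOnInterval γ.extend 0 1) (k : ℕ) :
    contourIntegral γ (fun z => z ^ k) = 0 := by
  refine contourIntegral_eq_zero_of_primitive hγ
    (F := fun z => ((k : ℂ) + 1)⁻¹ * z ^ (k + 1)) (fun z _ => by fun_prop) fun z _ => ?_
  refine ((hasDerivAt_pow (k + 1) z).const_mul ((k : ℂ) + 1)⁻¹).congr_deriv ?_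
  have hk : (k : ℂ) + 1 ≠ 0 := by exact_mod_cast k.succ_ne_zero
  simp [hk]

/-! ### Integrals with a single pole outside the curve -/

/-- The winding number is locally constant: for `w` closer to `w₀` than the curve is, the principal
logarithm of `(z - w) / (z - w₀)` is a primitive of the difference of the two integrands. -/
theorem contourIntegral_inv_sub_inv_eq (hγ : AbsolutelyContinuousOnInterval γ.extend 0 1)
    {w w₀ : ℂ} (hw : ∀ z ∈ Set.range γ, ‖w₀ - w‖ < ‖z - w₀‖) :
    contourIntegral γ (fun z => (z - w)⁻¹) = contourIntegral γ (fun z => (z - w₀)⁻¹) := by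
  have h0 : ∀ z ∈ Set.range γ, z - w₀ ≠ 0 := fun z hz h => by
    have := hw z hz
    rw [h, norm_zero] at this
    exact (norm_nonneg _).not_gt this
  have h1 : ∀ z ∈ Set.range γ, z - w ≠ 0 := fun z hz h => by
    have := hw z hz
    rw [sub_eq_zero.1 h, norm_sub_rev] at this
    exact lt_irrefl _ this
  have hslit : ∀ z ∈ Set.range γ, (z - w) / (z - w₀) ∈ Complex.slitPlane := fun z hz => by
    have : (z - w) / (z - w₀) = 1 + (w₀ - w) / (z - w₀) := by
      have := h0 z hz
      field_simp
      ring
    rw [this]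
    refine Complex.mem_slitPlane_of_norm_lt_one ?_
    rw [norm_div, div_lt_one (norm_pos_iff.2 (h0 z hz))]
    exact hw z hz
  have hcont : ∀ v : ℂ, (∀ z ∈ Set.range γ, z - v ≠ 0) →
      ContinuousOn (fun z => (z - v)⁻¹) (Set.range γ) := fun v hv =>
    (continuousOn_id.sub continuousOn_const).inv₀ hv
  have key : contourIntegral γ (fun z => (z - w)⁻¹ + (-1) * (z - w₀)⁻¹) = 0 := by
    refine contourIntegral_eq_zero_of_primitive hγ
      (F := fun z => Complex.log ((z - w) / (z - w₀))) (fun z hz => ?_) fun z hz => ?_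
    · exact ((analyticAt_id.sub analyticAt_const).div (analyticAt_id.sub analyticAt_const)
        (h0 z hz)).clog (hslit z hz)
    · have hd := (((hasDerivAt_id z).sub_const w).div ((hasDerivAt_id z).sub_const w₀)
        (h0 z hz)).clog (hslit z hz)
      refine hd.congr_deriv ?_
      have := h0 z hz
      have := h1 z hz
      simp only [id, Pi.div_apply]
      field_simp
      ring
  rw [contourIntegral_add (g := fun z => (-1) * (z - w₀)⁻¹) hγ (hcont w h1)
    (continuousOn_const.mul (hcont w₀ h0)), contourIntegral_const_mul] at key
  linear_combination key

/-- The winding number around a point far away from the curve is zero, as the principal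
logarithm of `1 - z / w` is a primitive of `(z - w)⁻¹` on a disc that contains the curve. -/
theorem contourIntegral_inv_sub_eq_zero_of_far
    (hγ : AbsolutelyContinuousOnInterval γ.extend 0 1) {w : ℂ}
    (hw : ∀ z ∈ Set.range γ, ‖z‖ < ‖w‖) :
    contourIntegral γ (fun z => (z - w)⁻¹) = 0 := by
  have hw0 : w ≠ 0 := by
    rintro rfl
    have := hw p ⟨0, γ.source⟩
    rw [norm_zero] at this
    exact (norm_nonneg _).not_gt this
  have h1 : ∀ z ∈ Set.range γ, z - w ≠ 0 := fun z hz h => by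
    have := hw z hz
    rw [sub_eq_zero.1 h] at this
    exact lt_irrefl _ this
  have hslit : ∀ z ∈ Set.range γ, 1 + (-z) / w ∈ Complex.slitPlane := fun z hz => by
    refine Complex.mem_slitPlane_of_norm_lt_one ?_
    rw [norm_div, norm_neg, div_lt_one (norm_pos_iff.2 hw0)]
    exact hw z hz
  refine contourIntegral_eq_zero_of_primitive hγ
      (F := fun z => Complex.log (1 + (-z) / w)) (fun z hz => ?_) fun z hz => ?_
  · exact (analyticAt_const.add (analyticAt_id.neg.div analyticAt_const hw0)).clog (hslit z hz)
  · have hd := (((hasDerivAt_id z).neg.div_const w).const_add 1).clog (hslit z hz)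
    refine hd.congr_deriv ?_
    have := h1 z hz
    have h2 : w - z ≠ 0 := fun h => this (by linear_combination -h)
    have h3 : (1 : ℂ) + -z / w = (w - z) / w := by field_simp; ring
    simp only [id, Pi.neg_apply, h3]
    rw [← neg_sub w z]
    field_simp

/-- The winding number of the curve around a point outside of it vanishes: it is constant on the
component of the point in the complement of the curve, and that component contains points far
away. -/
theorem contourIntegral_inv_sub_eq_zero (hγ : AbsolutelyContinuousOnInterval γ.extend 0 1) {w : ℂ}
    (hw : w ∉ Set.range γ) (hout : w ∉ inside γ) :
    contourIntegral γ (fun z => (z - w)⁻¹) = 0 := by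
  have hcomp : IsCompact (Set.range γ) := isCompact_range γ.continuous
  have hub : ¬ Bornology.IsBounded (connectedComponentIn (Set.range γ)ᶜ w) :=
    fun h => hout ⟨hw, h⟩
  obtain ⟨R, hR⟩ := hcomp.isBounded.exists_norm_le
  obtain ⟨v, hv, hvR⟩ : ∃ v ∈ connectedComponentIn (Set.range γ)ᶜ w, R < ‖v‖ := by
    by_contra! h
    exact hub (isBounded_iff_forall_norm_le.2 ⟨R, h⟩)
  have hconst : contourIntegral γ (fun z => (z - w)⁻¹) =
      contourIntegral γ (fun z => (z - v)⁻¹) := by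
    refine (isPreconnected_connectedComponentIn (x := w) (F := (Set.range γ)ᶜ)).induction₂
      (fun a b => contourIntegral γ (fun z => (z - a)⁻¹) = contourIntegral γ (fun z => (z - b)⁻¹))
      (fun a ha => ?_) (fun _ _ _ _ _ _ => Eq.trans) (fun _ _ _ _ => Eq.symm)
      (mem_connectedComponentIn hw) hv
    have hpos : 0 < Metric.infDist a (Set.range γ) :=
      (hcomp.isClosed.notMem_iff_infDist_pos ⟨p, 0, γ.source⟩).1
        (connectedComponentIn_subset _ _ ha)
    refine mem_nhdsWithin_of_mem_nhds (Filter.mem_of_superset (Metric.ball_mem_nhds a hpos) ?_)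
    intro b hb
    refine (contourIntegral_inv_sub_inv_eq hγ fun z hz => ?_).symm
    rw [← dist_eq_norm, ← dist_eq_norm, dist_comm a b, dist_comm z a]
    exact (Metric.mem_ball.1 hb).trans_le (Metric.infDist_le_dist_of_mem hz)
  rw [hconst]
  exact contourIntegral_inv_sub_eq_zero_of_far hγ fun z hz => (hR z hz).trans_lt hvR

/-- Every `z ^ k / (z - w) ^ j` with the pole `w` outside the curve integrates to zero: splitting
off factors `z = (z - w) + w` reduces to `k = 0` or `j = 0`, and then only the exponent `j = 1`
lacks a primitive. -/
theorem contourIntegral_inv_sub_pow_eq_zero (hγ : AbsolutelyContinuousOnInterval γ.extend 0 1)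
    {w : ℂ} (hw : w ∉ Set.range γ) (hout : w ∉ inside γ) (j k : ℕ) :
    contourIntegral γ (fun z => z ^ k * (z - w)⁻¹ ^ j) = 0 := by
  have h0 : ∀ z ∈ Set.range γ, z - w ≠ 0 := fun z hz h => hw (sub_eq_zero.1 h ▸ hz)
  have hcont : ∀ j k : ℕ, ContinuousOn (fun z => z ^ k * (z - w)⁻¹ ^ j) (Set.range γ) :=
    fun j k => (continuousOn_id.pow k).mul
      (((continuousOn_id.sub continuousOn_const).inv₀ h0).pow j)
  induction k generalizing j with
  | zero =>
    match j with
    | 0 =>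
      simpa using contourIntegral_pow_eq_zero hγ 0
    | 1 => simpa using contourIntegral_inv_sub_eq_zero hγ hw hout
    | j + 2 =>
      refine contourIntegral_eq_zero_of_primitive hγ
        (F := fun z => (-((j : ℂ) + 1)⁻¹) * (z - w)⁻¹ ^ (j + 1)) (fun z hz => ?_) fun z hz => ?_
      · exact analyticAt_const.mul
          (((analyticAt_id.sub analyticAt_const).inv (h0 z hz)).pow _)
      · have hd := (((((hasDerivAt_id z).sub_const w).inv (h0 z hz)).pow (j + 1)).const_mul
          (-((j : ℂ) + 1)⁻¹))
        refine hd.congr_deriv ?_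
        have := h0 z hz
        have hj : (j : ℂ) + 1 ≠ 0 := by exact_mod_cast j.succ_ne_zero
        simp only [id, Pi.inv_apply, Nat.add_sub_cancel, Nat.cast_add, Nat.cast_one, inv_pow]
        field_simp
        ring
  | succ k ih =>
    match j with
    | 0 =>
      simpa using contourIntegral_pow_eq_zero hγ (k + 1)
    | j + 1 =>
      have : ∀ z ∈ Set.range γ, z ^ (k + 1) * (z - w)⁻¹ ^ (j + 1) =
          z ^ k * (z - w)⁻¹ ^ j + w * (z ^ k * (z - w)⁻¹ ^ (j + 1)) := fun z hz => by
        linear_combination z ^ k * (z - w)⁻¹ ^ j * mul_inv_cancel₀ (h0 z hz)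
      rw [contourIntegral_congr this, contourIntegral_add hγ (hcont j k)
        (g := fun z => w * (z ^ k * (z - w)⁻¹ ^ (j + 1)))
        (continuousOn_const.mul (hcont (j + 1) k)), contourIntegral_const_mul, ih, ih]
      simp

/-! ### Coordinates adapted to the Weierstrass form -/

theorem sum_castLE_eq_sum_ite {m l : ℕ} (hl : l ≤ m) (d : Fin m → ℕ) :
    ∑ i : Fin l, d (Fin.castLE hl i) = ∑ i : Fin m, if (i : ℕ) < l then d i else 0 := by
  obtain ⟨r, rfl⟩ := Nat.exists_eq_add_of_le hl
  rw [Fin.sum_univ_add]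
  simp
  rfl

/-- The blocks are laid out consecutively: an index lies among the first `d 0 + ⋯ + d (l - 1)` ones
exactly when its block is one of the first `l`. -/
theorem finSigmaFinEquiv_lt_iff {m l : ℕ} (hl : l ≤ m) (d : Fin m → ℕ)
    (x : (i : Fin m) × Fin (d i)) :
    (finSigmaFinEquiv x : ℕ) < ∑ i : Fin l, d (Fin.castLE hl i) ↔ (x.1 : ℕ) < l := by
  obtain ⟨i, a⟩ := x
  rw [finSigmaFinEquiv_apply, sum_castLE_eq_sum_ite, sum_castLE_eq_sum_ite]
  constructor
  · intro h
    by_contra! hli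
    refine absurd h (not_lt.2 (le_trans (Finset.sum_le_sum fun k _ => ?_) (Nat.le_add_right _ _)))
    dsimp only at *
    split_ifs <;> omega
  · intro h
    have h1 : ∑ k : Fin m, (if (k : ℕ) < (i : ℕ) then d k else 0) + d i ≤
        ∑ k : Fin m, if (k : ℕ) < l then d k else 0 := by
      have h2 : d i = ∑ k : Fin m, if k = i then d k else 0 := by simp
      conv_lhs => rw [h2]
      rw [← Finset.sum_add_distrib]
      refine Finset.sum_le_sum fun k _ => ?_
      dsimp only at h
      simp only [Fin.ext_iff]
      split_ifs <;> omega
    have := a.isLt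
    dsimp only
    omega

/-- Downward induction on `Fin k`; at the last index the hypothesis of the step is vacuous. -/
theorem forall_fin_of_succ {k : ℕ} {P : Fin k → Prop}
    (h : ∀ a : Fin k, (∀ ha : (a : ℕ) + 1 < k, P ⟨a + 1, ha⟩) → P a) (a : Fin k) : P a := by
  induction hr : k - a using Nat.strong_induction_on generalizing a with
  | _ r ih => exact h a fun ha => ih _ (by simp only; omega) ⟨a + 1, ha⟩ rfl

theorem jordanBlock_mulVec {k : ℕ} (μ : ℂ) (x : Fin k → ℂ) (a : Fin k) :
    (jordanBlock k μ *ᵥ x) a = μ * x a + if h : (a : ℕ) + 1 < k then x ⟨a + 1, h⟩ else 0 := by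
  have : ∀ b : Fin k, jordanBlock k μ a b * x b =
      (if b = a then μ * x a else 0) + if (a : ℕ) + 1 = b then x b else 0 := by
    intro b
    simp only [jordanBlock, of_apply, @eq_comm _ a b]
    by_cases h : b = a
    · subst h; simp
    · simp [h]
  rw [mulVec, dotProduct, Finset.sum_congr rfl fun b _ => this b, Finset.sum_add_distrib]
  simp only [Finset.sum_ite_eq', Finset.mem_univ, if_true]
  congr 1
  split_ifs with h
  · rw [Finset.sum_eq_single ⟨a + 1, h⟩]
    · simp
    · intro b _ hb
      rw [if_neg fun h' => hb (Fin.ext h'.symm)]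
    · simp
  · exact Finset.sum_eq_zero fun b _ => if_neg (by omega)

theorem jordanMatrix_mulVec {m : ℕ} (d : Fin m → ℕ) (μ : Fin m → ℂ)
    (x : Fin (∑ i, d i) → ℂ) (i : Fin m) (a : Fin (d i)) :
    (jordanMatrix d μ *ᵥ x) (finSigmaFinEquiv ⟨i, a⟩) = μ i * x (finSigmaFinEquiv ⟨i, a⟩) +
      if h : (a : ℕ) + 1 < d i then x (finSigmaFinEquiv ⟨i, ⟨a + 1, h⟩⟩) else 0 := by
  rw [← jordanBlock_mulVec (μ i) (fun b => x (finSigmaFinEquiv ⟨i, b⟩)) a, jordanMatrix,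
    mulVec, mulVec, dotProduct, dotProduct, ← finSigmaFinEquiv.sum_comp, Fintype.sum_sigma,
    Finset.sum_eq_single i]
  · simp
  · intro k _ hk
    refine Finset.sum_eq_zero fun b _ => ?_
    simp [blockDiagonal'_apply_ne _ _ _ hk.symm]
  · simp

theorem diagBlocks_mulVec_castAdd {a b n : ℕ} (h : a + b = n) (P : Matrix (Fin a) (Fin a) ℂ)
    (Q : Matrix (Fin b) (Fin b) ℂ) (x : Fin n → ℂ) (i : Fin a) :
    (diagBlocks h P Q *ᵥ x) (Fin.cast h (Fin.castAdd b i)) =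
      (P *ᵥ fun k => x (Fin.cast h (Fin.castAdd b k))) i := by
  subst h
  simp only [diagBlocks, mulVec, dotProduct, Fin.sum_univ_add]
  simp

theorem diagBlocks_mulVec_natAdd {a b n : ℕ} (h : a + b = n) (P : Matrix (Fin a) (Fin a) ℂ)
    (Q : Matrix (Fin b) (Fin b) ℂ) (x : Fin n → ℂ) (i : Fin b) :
    (diagBlocks h P Q *ᵥ x) (Fin.cast h (Fin.natAdd a i)) =
      (Q *ᵥ fun k => x (Fin.cast h (Fin.natAdd a k))) i := by
  subst h
  simp only [diagBlocks, mulVec, dotProduct, Fin.sum_univ_add]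
  simp

namespace WeierstrassForm

variable {n : ℕ} {A B : Matrix (Fin n) (Fin n) ℂ} (W : WeierstrassForm A B)

/-- The position, among the `n` coordinates, of the `a`-th coordinate of the `i`-th Jordan block
of `J`. -/
def finiteIndex (i : Fin W.m) (a : Fin (W.d i)) : Fin n :=
  Fin.cast W.size_eq (Fin.castAdd _ (finSigmaFinEquiv ⟨i, a⟩))

/-- The position, among the `n` coordinates, of the `b`-th coordinate of the `j`-th Jordan block
of `N`. -/
def infiniteIndex (j : Fin W.r) (b : Fin (W.e j)) : Fin n :=
  Fin.cast W.size_eq (Fin.natAdd _ (finSigmaFinEquiv ⟨j, b⟩))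

theorem index_cases {P : Fin n → Prop} (hf : ∀ i a, P (W.finiteIndex i a))
    (hi : ∀ j b, P (W.infiniteIndex j b)) (q : Fin n) : P q := by
  have h : ∀ q' : Fin (∑ i, W.d i + ∑ j, W.e j), P (Fin.cast W.size_eq q') := by
    intro q'
    induction q' using Fin.addCases with
    | left q' =>
      obtain ⟨⟨i, a⟩, rfl⟩ := finSigmaFinEquiv.surjective q'
      exact hf i a
    | right q' =>
      obtain ⟨⟨j, b⟩, rfl⟩ := finSigmaFinEquiv.surjective q'
      exact hi j b
  exact h (Fin.cast W.size_eq.symm q)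

theorem finiteIndex_val (i : Fin W.m) (a : Fin (W.d i)) :
    (W.finiteIndex i a : ℕ) = ∑ k : Fin i, W.d (Fin.castLE i.2.le k) + a := by
  simp only [finiteIndex, Fin.val_cast, Fin.val_castAdd, finSigmaFinEquiv_apply]

theorem infiniteIndex_val (j : Fin W.r) (b : Fin (W.e j)) :
    (W.infiniteIndex j b : ℕ) =
      ∑ i, W.d i + (∑ k : Fin j, W.e (Fin.castLE j.2.le k) + b) := by
  simp only [infiniteIndex, Fin.val_cast, Fin.val_natAdd, finSigmaFinEquiv_apply]

theorem finiteIndex_inj {i i' : Fin W.m} {a : Fin (W.d i)} {a' : Fin (W.d i')} :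
    W.finiteIndex i a = W.finiteIndex i' a' ↔ i = i' ∧ (a : ℕ) = a' := by
  constructor
  · intro h
    have h1 : (⟨i, a⟩ : (i : Fin W.m) × Fin (W.d i)) = ⟨i', a'⟩ := by
      apply finSigmaFinEquiv.injective
      exact Fin.castAdd_injective _ _ (Fin.cast_injective _ h)
    cases h1
    exact ⟨rfl, rfl⟩
  · rintro ⟨rfl, h⟩
    rw [Fin.ext h]

theorem infiniteIndex_ne_finiteIndex (j : Fin W.r) (b : Fin (W.e j)) (i : Fin W.m)
    (a : Fin (W.d i)) : W.infiniteIndex j b ≠ W.finiteIndex i a := by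
  intro h
  have := congrArg Fin.val h
  simp only [infiniteIndex, finiteIndex, Fin.val_cast, Fin.val_castAdd, Fin.val_natAdd] at this
  have := (finSigmaFinEquiv (n := W.d) ⟨i, a⟩).isLt
  omega

theorem finiteIndex_lt_iff {l : ℕ} (hl : l ≤ W.m) (i : Fin W.m) (a : Fin (W.d i)) :
    (W.finiteIndex i a : ℕ) < ∑ i : Fin l, W.d (Fin.castLE hl i) ↔ (i : ℕ) < l :=
  finSigmaFinEquiv_lt_iff hl W.d ⟨i, a⟩

theorem le_infiniteIndex {l : ℕ} (hl : l ≤ W.m) (j : Fin W.r) (b : Fin (W.e j)) :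
    ∑ i : Fin l, W.d (Fin.castLE hl i) ≤ W.infiniteIndex j b := by
  rw [infiniteIndex_val, sum_castLE_eq_sum_ite]
  refine le_trans (Finset.sum_le_sum fun i _ => ?_) (Nat.le_add_right _ _)
  split_ifs <;> simp

theorem A_mulVec_finiteIndex (x : Fin n → ℂ) (i : Fin W.m) (a : Fin (W.d i)) :
    ((W.T * A * W.S) *ᵥ x) (W.finiteIndex i a) = W.lam i * x (W.finiteIndex i a) +
      if h : (a : ℕ) + 1 < W.d i then x (W.finiteIndex i ⟨a + 1, h⟩) else 0 := by
  rw [W.mul_A_mul, finiteIndex, diagBlocks_mulVec_castAdd, jordanMatrix_mulVec]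
  rfl

theorem B_mulVec_finiteIndex (x : Fin n → ℂ) (i : Fin W.m) (a : Fin (W.d i)) :
    ((W.T * B * W.S) *ᵥ x) (W.finiteIndex i a) = x (W.finiteIndex i a) := by
  rw [W.mul_B_mul, finiteIndex, diagBlocks_mulVec_castAdd, one_mulVec]

theorem A_mulVec_infiniteIndex (x : Fin n → ℂ) (j : Fin W.r) (b : Fin (W.e j)) :
    ((W.T * A * W.S) *ᵥ x) (W.infiniteIndex j b) = x (W.infiniteIndex j b) := by
  rw [W.mul_A_mul, infiniteIndex, diagBlocks_mulVec_natAdd, one_mulVec]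

theorem B_mulVec_infiniteIndex (x : Fin n → ℂ) (j : Fin W.r) (b : Fin (W.e j)) :
    ((W.T * B * W.S) *ᵥ x) (W.infiniteIndex j b) =
      if h : (b : ℕ) + 1 < W.e j then x (W.infiniteIndex j ⟨b + 1, h⟩) else 0 := by
  rw [W.mul_B_mul, infiniteIndex, diagBlocks_mulVec_natAdd, jordanMatrix_mulVec, zero_mul, zero_add]
  rfl

/-! ### The spaces spanned by Jordan chains -/

theorem S_mulVec_inv_mulVec (x : Fin n → ℂ) : W.S *ᵥ (W.S⁻¹ *ᵥ x) = x := by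
  rw [mulVec_mulVec, mul_nonsing_inv _ ((isUnit_iff_isUnit_det _).1 W.isUnit_S), one_mulVec]

theorem inv_mulVec_S_mulVec (x : Fin n → ℂ) : W.S⁻¹ *ᵥ (W.S *ᵥ x) = x := by
  rw [mulVec_mulVec, nonsing_inv_mul _ ((isUnit_iff_isUnit_det _).1 W.isUnit_S), one_mulVec]

theorem mem_firstColSpan_iff (s : ℕ) (x : Fin n → ℂ) :
    x ∈ firstColSpan W.S s ↔ ∀ q : Fin n, s ≤ q → (W.S⁻¹ *ᵥ x) q = 0 := by
  constructor
  · intro hx q hq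
    induction hx using Submodule.span_induction with
    | mem x hx =>
      obtain ⟨j, hj, rfl⟩ := hx
      rw [← mulVec_single_one, inv_mulVec_S_mulVec, Pi.single_eq_of_ne]
      rintro rfl
      exact absurd hj (not_lt.2 hq)
    | zero => simp
    | add x y _ _ hx hy => rw [mulVec_add, Pi.add_apply, hx, hy, add_zero]
    | smul c x _ hx => rw [mulVec_smul, Pi.smul_apply, hx, smul_zero]
  · intro h
    rw [← W.S_mulVec_inv_mulVec x, mulVec_eq_sum]
    refine Submodule.sum_mem _ fun q _ => ?_
    rw [op_smul_eq_smul]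
    by_cases hq : s ≤ q
    · rw [h q hq, zero_smul]
      exact zero_mem _
    · exact Submodule.smul_mem _ _
        (Submodule.subset_span (Set.mem_image_of_mem W.S.col (not_le.1 hq)))

/-- In the coordinates of the Weierstrass form the chain condition reads `(J - μ) x₁ = y₁` and
`(1 - μ N) x₂ = N y₂`. By back substitution, the coordinates of `x` in the infinite part and in the
blocks with `λ_i ≠ μ` vanish when those of `y` do. -/
theorem jordanChains_le_firstColSpan {μ : ℂ} {s : ℕ}
    (hs : ∀ i a, W.lam i = μ → (W.finiteIndex i a : ℕ) < s)
    (hsi : ∀ j b, s ≤ W.infiniteIndex j b) (k : ℕ) :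
    jordanChains A B μ k ≤ firstColSpan W.S s := by
  induction k with
  | zero => exact bot_le
  | succ k ih =>
    rintro x ⟨y, hy, hxy⟩
    have hy0 := (W.mem_firstColSpan_iff s y).1 (ih hy)
    rw [W.mem_firstColSpan_iff]
    set x' := W.S⁻¹ *ᵥ x with hx'
    set y' := W.S⁻¹ *ᵥ y with hy'
    have key : (W.T * A * W.S) *ᵥ x' - μ • ((W.T * B * W.S) *ᵥ x') = (W.T * B * W.S) *ᵥ y' := by
      simp only [mulVecLin_apply] at hxy
      simp only [← mulVec_mulVec, hx', hy', S_mulVec_inv_mulVec, hxy, sub_mulVec, smul_mulVec,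
        mulVec_sub, mulVec_smul]
    refine W.index_cases (fun i a => ?_) fun j b _ => ?_
    · refine forall_fin_of_succ (P := fun a => s ≤ (W.finiteIndex i a : ℕ) →
        x' (W.finiteIndex i a) = 0) (fun a ih hsa => ?_) a
      have hne : W.lam i - μ ≠ 0 := fun h => absurd (hs i a (sub_eq_zero.1 h)) (not_lt.2 hsa)
      have h := congrFun key (W.finiteIndex i a)
      rw [Pi.sub_apply, Pi.smul_apply, A_mulVec_finiteIndex, B_mulVec_finiteIndex,
        B_mulVec_finiteIndex, hy0 _ hsa, smul_eq_mul] at h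
      have hnext :
          (if h : (a : ℕ) + 1 < W.d i then x' (W.finiteIndex i ⟨a + 1, h⟩) else 0) = 0 := by
        split_ifs with ha
        · refine ih ha (hsa.trans ?_)
          simp only [finiteIndex_val]
          omega
        · rfl
      rw [hnext] at h
      exact (mul_eq_zero.1 (by linear_combination h : (W.lam i - μ) * x' (W.finiteIndex i a) = 0))
        |>.resolve_left hne
    · refine forall_fin_of_succ (P := fun b => x' (W.infiniteIndex j b) = 0) (fun b ih => ?_) b
      have h := congrFun key (W.infiniteIndex j b)
      rw [Pi.sub_apply, Pi.smul_apply, A_mulVec_infiniteIndex, B_mulVec_infiniteIndex,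
        B_mulVec_infiniteIndex] at h
      split_ifs at h with hb
      · rw [ih hb, hy0 _ (hsi j _)] at h
        simpa using h
      · simpa using h

/-- The columns of `S` belonging to one Jordan block form a Jordan chain of the pencil. -/
theorem sub_smul_mulVec_S_col (i : Fin W.m) (a : Fin (W.d i)) :
    (A - W.lam i • B) *ᵥ W.S.col (W.finiteIndex i a) =
      B *ᵥ if 0 < (a : ℕ) then W.S.col (W.finiteIndex i ⟨a - 1, by omega⟩) else 0 := by
  -- It suffices to compare both sides in the coordinates of the Weierstrass form.
  apply mulVec_injective_of_isUnit W.isUnit_T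
  set e : Fin n → ℂ := Pi.single (W.finiteIndex i a) 1 with he
  set e' : Fin n → ℂ :=
    if 0 < (a : ℕ) then Pi.single (W.finiteIndex i ⟨a - 1, by omega⟩) 1 else 0 with he'
  have h1 : W.S.col (W.finiteIndex i a) = W.S *ᵥ e := (mulVec_single_one _ _).symm
  have h2 : (if 0 < (a : ℕ) then W.S.col (W.finiteIndex i ⟨a - 1, by omega⟩) else 0) =
      W.S *ᵥ e' := by
    rw [he']
    split_ifs
    · exact (mulVec_single_one _ _).symm
    · exact (mulVec_zero _).symm
  suffices (W.T * A * W.S) *ᵥ e - W.lam i • ((W.T * B * W.S) *ᵥ e) = (W.T * B * W.S) *ᵥ e' by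
    rw [h1, h2]
    simpa only [← mulVec_mulVec, sub_mulVec, smul_mulVec, mulVec_sub, mulVec_smul] using this
  have hef : ∀ i' a', e (W.finiteIndex i' a') = if i' = i ∧ (a' : ℕ) = a then 1 else 0 :=
    fun i' a' => by simp only [he, Pi.single_apply, finiteIndex_inj]
  have hef' : ∀ i' a', e' (W.finiteIndex i' a') =
      if i' = i ∧ (a' : ℕ) + 1 = a then 1 else 0 := fun i' a' => by
    rw [he']
    split_ifs with h0 h1 h1
    · rw [Pi.single_apply, if_pos]
      exact W.finiteIndex_inj.2 ⟨h1.1, by simp only; omega⟩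
    · rw [Pi.single_apply, if_neg]
      intro h
      have h' := W.finiteIndex_inj.1 h
      exact h1 ⟨h'.1, by have := h'.2; simp only at this; omega⟩
    · omega
    · rfl
  have hei : ∀ j b, e (W.infiniteIndex j b) = 0 := fun j b =>
    Pi.single_eq_of_ne (W.infiniteIndex_ne_finiteIndex j b i a) _
  have hei' : ∀ j b, e' (W.infiniteIndex j b) = 0 := fun j b => by
    rw [he']
    split_ifs
    · exact Pi.single_eq_of_ne (W.infiniteIndex_ne_finiteIndex j b i _) _
    · rfl
  ext q
  refine W.index_cases (P := fun q => ((W.T * A * W.S) *ᵥ e - W.lam i • ((W.T * B * W.S) *ᵥ e)) q =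
    ((W.T * B * W.S) *ᵥ e') q) (fun i' a' => ?_) (fun j b => ?_) q
  · rw [Pi.sub_apply, Pi.smul_apply, A_mulVec_finiteIndex, B_mulVec_finiteIndex,
      B_mulVec_finiteIndex, smul_eq_mul, hef, hef']
    have hnext : (if h : (a' : ℕ) + 1 < W.d i' then e (W.finiteIndex i' ⟨a' + 1, h⟩) else 0) =
        if i' = i ∧ (a' : ℕ) + 1 = a then 1 else 0 := by
      split_ifs with h1 h2 h2
      · rw [hef, if_pos h2]
      · rw [hef, if_neg h2]
      · obtain ⟨rfl, h2⟩ := h2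
        omega
      · rfl
    rw [hnext]
    by_cases hi : i' = i
    · subst hi; ring
    · simp [hi]
  · rw [Pi.sub_apply, Pi.smul_apply, A_mulVec_infiniteIndex, B_mulVec_infiniteIndex,
      B_mulVec_infiniteIndex]
    simp [hei, hei']

theorem S_col_mem_jordanChains (i : Fin W.m) (a : Fin (W.d i)) :
    W.S.col (W.finiteIndex i a) ∈ jordanChains A B (W.lam i) (a + 1) := by
  obtain ⟨a, ha⟩ := a
  induction a with
  | zero =>
    refine ⟨0, zero_mem _, ?_⟩
    rw [mulVecLin_apply, mulVecLin_apply, sub_smul_mulVec_S_col]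
    simp
  | succ a ih =>
    refine ⟨_, ih (by omega), ?_⟩
    rw [mulVecLin_apply, mulVecLin_apply, sub_smul_mulVec_S_col]
    simp

/-- Each `λ_i` is an eigenvalue of the pencil. As blocks are nonempty, the first column of `S` in
the `i`-th block is an eigenvector. -/
theorem det_lam_smul_sub (i : Fin W.m) : (W.lam i • B - A).det = 0 := by
  rw [← exists_mulVec_eq_zero_iff]
  refine ⟨W.S.col (W.finiteIndex i ⟨0, W.d_pos i⟩), fun h => ?_, ?_⟩
  · have h1 := W.inv_mulVec_S_mulVec (Pi.single (W.finiteIndex i ⟨0, W.d_pos i⟩) 1)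
    rw [mulVec_single_one, h, mulVec_zero] at h1
    simpa using congrFun h1 (W.finiteIndex i ⟨0, W.d_pos i⟩)
  · rw [← neg_sub, neg_mulVec, sub_smul_mulVec_S_col]
    simp

theorem firstColSpan_eq_iSup_genEigenspace {Ω : Set ℂ} {l : ℕ} (hl : l ≤ W.m)
    (hin : ∀ i : Fin W.m, W.lam i ∈ Ω ↔ (i : ℕ) < l) :
    firstColSpan W.S (∑ i : Fin l, W.d (Fin.castLE hl i)) =
      ⨆ μ ∈ Ω, genEigenspace A B μ := by
  apply le_antisymm
  · refine Submodule.span_le.2 ?_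
    rintro _ ⟨q, hq, rfl⟩
    revert hq
    refine W.index_cases (P := fun q => (q : ℕ) < ∑ i : Fin l, W.d (Fin.castLE hl i) →
      W.S.col q ∈ ⨆ μ ∈ Ω, genEigenspace A B μ) (fun i a h => ?_) (fun j b h => ?_) q
    · have hi := (hin i).2 ((W.finiteIndex_lt_iff hl i a).1 h)
      exact le_iSup₂_of_le (f := fun μ (_ : μ ∈ Ω) => genEigenspace A B μ) (W.lam i) hi
        (le_iSup (jordanChains A B (W.lam i)) (a + 1)) (W.S_col_mem_jordanChains i a)
    · exact absurd h (not_lt.2 (W.le_infiniteIndex hl j b))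
  · refine iSup₂_le fun μ hμ => iSup_le fun k => W.jordanChains_le_firstColSpan (fun i a h => ?_)
      (W.le_infiniteIndex hl) k
    exact (W.finiteIndex_lt_iff hl i a).2 ((hin i).1 (h ▸ hμ))

/-! ### Counting the eigenvalues -/

/-- On and below the diagonal, `T A S` and `T B S` have no entry other than the diagonal ones. -/
theorem A_finiteIndex_apply (i : Fin W.m) (a : Fin (W.d i)) (q : Fin n)
    (hq : q ≤ W.finiteIndex i a) :
    (W.T * A * W.S) (W.finiteIndex i a) q = if q = W.finiteIndex i a then W.lam i else 0 := by
  have h := W.A_mulVec_finiteIndex (Pi.single q 1) i a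
  rw [mulVec_single_one, col_apply] at h
  have h0 : (if h : (a : ℕ) + 1 < W.d i then (Pi.single q 1 : Fin n → ℂ)
      (W.finiteIndex i ⟨a + 1, h⟩) else 0) = 0 := by
    split_ifs with ha
    · refine Pi.single_eq_of_ne (fun h => ?_) _
      rw [← h, Fin.le_def, finiteIndex_val, finiteIndex_val] at hq
      simp only at hq
      omega
    · rfl
  rw [h, h0, add_zero, Pi.single_apply]
  simp only [eq_comm (a := q)]
  split_ifs <;> simp

theorem B_finiteIndex_apply (i : Fin W.m) (a : Fin (W.d i)) (q : Fin n) :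
    (W.T * B * W.S) (W.finiteIndex i a) q = if q = W.finiteIndex i a then 1 else 0 := by
  have h := W.B_mulVec_finiteIndex (Pi.single q 1) i a
  rw [mulVec_single_one, col_apply] at h
  rw [h, Pi.single_apply]
  simp only [eq_comm (a := q)]

theorem A_infiniteIndex_apply (j : Fin W.r) (b : Fin (W.e j)) (q : Fin n) :
    (W.T * A * W.S) (W.infiniteIndex j b) q = if q = W.infiniteIndex j b then 1 else 0 := by
  have h := W.A_mulVec_infiniteIndex (Pi.single q 1) j b
  rw [mulVec_single_one, col_apply] at h
  rw [h, Pi.single_apply]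
  simp only [eq_comm (a := q)]

theorem B_infiniteIndex_apply (j : Fin W.r) (b : Fin (W.e j)) (q : Fin n)
    (hq : q ≤ W.infiniteIndex j b) : (W.T * B * W.S) (W.infiniteIndex j b) q = 0 := by
  have h := W.B_mulVec_infiniteIndex (Pi.single q 1) j b
  rw [mulVec_single_one, col_apply] at h
  rw [h]
  split_ifs with ha
  · refine Pi.single_eq_of_ne (fun h => ?_) _
    rw [← h, Fin.le_def, infiniteIndex_val, infiniteIndex_val] at hq
    simp only at hq
    omega
  · rfl

open Polynomial in
/-- In the coordinates of the Weierstrass form the pencil is upper triangular, with diagonal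
entries `X - λ_i` on the finite part and `-1` on the infinite part. -/
theorem C_mul_pencilPoly_mul_C :
    C W.T.det * pencilPoly A B * C W.S.det =
      C ((-1) ^ (∑ j, W.e j)) * ∏ x : (i : Fin W.m) × Fin (W.d i), (X - C (W.lam x.1)) := by
  set M : Matrix (Fin n) (Fin n) ℂ[X] :=
    (X : ℂ[X]) • (W.T * B * W.S).map C - (W.T * A * W.S).map C with hM
  have h1 : C W.T.det * pencilPoly A B * C W.S.det = M.det := by
    rw [RingHom.map_det, RingHom.map_det, pencilPoly, ← det_mul, ← det_mul, hM]
    congr 1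
    simp only [RingHom.mapMatrix_apply, Matrix.map_mul, Matrix.mul_sub, Matrix.sub_mul,
      Matrix.mul_smul, Matrix.smul_mul]
  have hMapp : ∀ q r, M q r = X * C ((W.T * B * W.S) q r) - C ((W.T * A * W.S) q r) :=
    fun q r => rfl
  have htri : M.IsUpperTriangular := by
    intro q r
    change r < q → M q r = 0
    refine W.index_cases (P := fun q => r < q → M q r = 0) (fun i a h => ?_) (fun j b h => ?_) q
    · rw [hMapp, B_finiteIndex_apply, A_finiteIndex_apply _ _ _ _ h.le, if_neg h.ne, if_neg h.ne]
      simp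
    · rw [hMapp, A_infiniteIndex_apply, B_infiniteIndex_apply _ _ _ _ h.le, if_neg h.ne]
      simp
  rw [h1, det_of_isUpperTriangular htri, ← (finCongr W.size_eq).prod_comp, Fin.prod_univ_add,
    mul_comm]
  congr 1
  · have : ∀ k : Fin (∑ j, W.e j), M (finCongr W.size_eq (Fin.natAdd _ k))
        (finCongr W.size_eq (Fin.natAdd _ k)) = -1 := by
      intro k
      obtain ⟨⟨j, b⟩, rfl⟩ := finSigmaFinEquiv.surjective k
      change M (W.infiniteIndex j b) (W.infiniteIndex j b) = -1
      rw [hMapp, A_infiniteIndex_apply, B_infiniteIndex_apply _ _ _ _ le_rfl, if_pos rfl]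
      simp
    rw [Finset.prod_congr rfl fun k _ => this k]
    simp
  · rw [← finSigmaFinEquiv.prod_comp]
    refine Finset.prod_congr rfl fun x _ => ?_
    change M (W.finiteIndex x.1 x.2) (W.finiteIndex x.1 x.2) = _
    rw [hMapp, B_finiteIndex_apply, A_finiteIndex_apply _ _ _ _ le_rfl, if_pos rfl, if_pos rfl]
    simp

open Polynomial in
theorem roots_pencilPoly :
    (pencilPoly A B).roots =
      (Finset.univ : Finset ((i : Fin W.m) × Fin (W.d i))).val.map fun x => W.lam x.1 := by
  have hT := ((isUnit_iff_isUnit_det _).1 W.isUnit_T).ne_zero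
  have hS := ((isUnit_iff_isUnit_det _).1 W.isUnit_S).ne_zero
  have h := congrArg roots W.C_mul_pencilPoly_mul_C
  rw [mul_comm, roots_C_mul _ hS, roots_C_mul _ hT,
    roots_C_mul _ (pow_ne_zero _ (by norm_num))] at h
  rw [h, ← roots_multiset_prod_X_sub_C (Multiset.map _ _), Multiset.map_map]
  rfl

theorem eigenvalueCount_eq {Ω : Set ℂ} {l : ℕ} (hl : l ≤ W.m)
    (hin : ∀ i : Fin W.m, W.lam i ∈ Ω ↔ (i : ℕ) < l) :
    eigenvalueCount A B Ω = ∑ i : Fin l, W.d (Fin.castLE hl i) := by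
  classical
  rw [eigenvalueCount, roots_pencilPoly W, ← Multiset.countP_eq_card_filter, Multiset.countP_map,
    ← Finset.filter_val, Finset.card_val, Finset.card_filter, Fintype.sum_sigma,
    sum_castLE_eq_sum_ite]
  refine Finset.sum_congr rfl fun i _ => ?_
  simp only [hin]
  split_ifs <;> simp

end WeierstrassForm

/-! ### The range of the moment matrices -/

theorem contourIntegral_sum {ι : Type*} (hγ : AbsolutelyContinuousOnInterval γ.extend 0 1)
    (t : Finset ι) (f : ι → ℂ → ℂ) (hf : ∀ i ∈ t, ContinuousOn (f i) (Set.range γ)) :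
    contourIntegral γ (fun z => ∑ i ∈ t, f i z) = ∑ i ∈ t, contourIntegral γ (f i) := by
  simp only [contourIntegral_eq, Finset.sum_mul]
  exact intervalIntegral.integral_finsetSum fun i hi => intervalIntegrable_mul_deriv hγ (hf i hi)

/-- The function `f` is continuous on the curve and integrates to zero against all monomials
`z ^ k * w z ^ j`. This class is closed under multiplication by `z` and by `w`. The weight `w` is
`(z - λ)⁻¹` for functions whose only pole is at `λ`, and `1` for polynomials. -/
structure IsNull (γ : Path p p) (w f : ℂ → ℂ) : Prop where
  continuousOn : ContinuousOn f (Set.range γ)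
  integral_eq_zero : ∀ k j : ℕ, contourIntegral γ (fun z => z ^ k * w z ^ j * f z) = 0

namespace IsNull

variable {w f f' : ℂ → ℂ}

theorem congr (hf : IsNull γ w f) (h : ∀ z ∈ Set.range γ, f' z = f z) : IsNull γ w f' :=
  ⟨hf.continuousOn.congr h, fun k j =>
    (contourIntegral_congr fun z hz => by rw [h z hz]).trans (hf.integral_eq_zero k j)⟩

theorem const (h : ∀ k j : ℕ, contourIntegral γ (fun z => z ^ k * w z ^ j) = 0) (c : ℂ) :
    IsNull γ w fun _ => c :=
  ⟨continuousOn_const, fun k j => by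
    simp only [mul_comm _ c, contourIntegral_const_mul, h, mul_zero]⟩

theorem add (hγ : AbsolutelyContinuousOnInterval γ.extend 0 1)
    (hw : ContinuousOn w (Set.range γ)) (hf : IsNull γ w f) (hf' : IsNull γ w f') :
    IsNull γ w fun z => f z + f' z :=
  ⟨hf.continuousOn.add hf'.continuousOn, fun k j => by
    have hc : ContinuousOn (fun z => z ^ k * w z ^ j) (Set.range γ) :=
      (continuousOn_id.pow k).mul (hw.pow j)
    simp only [mul_add]
    rw [contourIntegral_add (f := fun z => z ^ k * w z ^ j * f z)
      (g := fun z => z ^ k * w z ^ j * f' z) hγ (hc.mul hf.continuousOn)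
      (hc.mul hf'.continuousOn), hf.integral_eq_zero, hf'.integral_eq_zero, add_zero]⟩

theorem weight_mul (hw : ContinuousOn w (Set.range γ)) (hf : IsNull γ w f) :
    IsNull γ w fun z => w z * f z :=
  ⟨hw.mul hf.continuousOn, fun k j => by
    rw [← hf.integral_eq_zero k (j + 1)]
    congr 1
    ext z
    ring⟩

theorem id_mul (hf : IsNull γ w f) : IsNull γ w fun z => z * f z :=
  ⟨continuousOn_id.mul hf.continuousOn, fun k j => by
    rw [← hf.integral_eq_zero (k + 1) j]
    congr 1
    ext z
    ring⟩

end IsNull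

namespace WeierstrassForm

variable {n : ℕ} {A B : Matrix (Fin n) (Fin n) ℂ} (W : WeierstrassForm A B)

theorem continuousOn_pencil_inv (hoff : ∀ z ∈ Set.range γ, (z • B - A).det ≠ 0) :
    ContinuousOn (fun z => (z • B - A)⁻¹) (Set.range γ) := by
  have hc : Continuous fun z : ℂ => z • B - A := by fun_prop
  simp only [inv_def, Ring.inverse_eq_inv']
  exact (hc.matrix_det.continuousOn.inv₀ hoff).smul hc.matrix_adjugate.continuousOn

/-- The coordinates of `S⁻¹ (z B - A)⁻¹ B` beyond the first `s` integrate to zero. Multiplied out,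
the resolvent equation says that its coordinates within one Jordan block solve a triangular
recursion. Starting at the last coordinate, one divides by `z - λ_i` on the finite part and
multiplies by `z` on the infinite part, so the only pole is `λ_i`. -/
theorem integral_resolvent_eq_zero (hγ : AbsolutelyContinuousOnInterval γ.extend 0 1)
    (hoff : ∀ z ∈ Set.range γ, (z • B - A).det ≠ 0) {s : ℕ}
    (hs : ∀ i a, W.lam i ∈ inside γ → (W.finiteIndex i a : ℕ) < s)
    (q c : Fin n) (hq : s ≤ q) (k : ℕ) :
    contourIntegral γ (fun z => z ^ k * (W.S⁻¹ * ((z • B - A)⁻¹ * B)) q c) = 0 := by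
  set v : ℂ → Fin n → ℂ := fun z => (W.S⁻¹ * ((z • B - A)⁻¹ * B)).col c with hv
  set b₀ : Fin n → ℂ := (W.T * B).col c
  have key : ∀ z ∈ Set.range γ,
      z • ((W.T * B * W.S) *ᵥ v z) - (W.T * A * W.S) *ᵥ v z = b₀ := by
    intro z hz
    have hSi : W.S * W.S⁻¹ = 1 := mul_nonsing_inv _ ((isUnit_iff_isUnit_det _).1 W.isUnit_S)
    have hPi : (z • B - A) * (z • B - A)⁻¹ = 1 := mul_nonsing_inv _ (hoff z hz).isUnit
    have h1 : W.T * (z • B - A) * W.S * (W.S⁻¹ * ((z • B - A)⁻¹ * B)) = W.T * B := by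
      calc W.T * (z • B - A) * W.S * (W.S⁻¹ * ((z • B - A)⁻¹ * B))
          = W.T * ((z • B - A) * (W.S * W.S⁻¹) * (z • B - A)⁻¹) * B := by
            simp only [Matrix.mul_assoc]
        _ = W.T * B := by rw [hSi, Matrix.mul_one, hPi, Matrix.mul_one]
    have h2 := congrArg (fun M => M *ᵥ Pi.single c 1) h1
    simp only [← mulVec_mulVec] at h2
    simp only [hv, ← mulVec_single_one, b₀, ← mulVec_mulVec]
    rw [← h2]
    simp only [sub_mulVec, smul_mulVec, mulVec_sub, mulVec_smul]
  suffices ∃ w : ℂ → ℂ, IsNull γ w fun z => v z q by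
    obtain ⟨w, hw⟩ := this
    simpa [hv] using hw.integral_eq_zero k 0
  revert hq
  refine W.index_cases (P := fun q => s ≤ (q : ℕ) → ∃ w : ℂ → ℂ, IsNull γ w fun z => v z q)
    (fun i a ha => ?_) (fun j b _ => ?_) q
  · have hout : W.lam i ∉ inside γ := fun h => absurd (hs i a h) (not_lt.2 ha)
    have hrange : W.lam i ∉ Set.range γ := fun h => hoff _ h (W.det_lam_smul_sub i)
    have h0 : ∀ z ∈ Set.range γ, z - W.lam i ≠ 0 := fun z hz h => hrange (sub_eq_zero.1 h ▸ hz)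
    have hw : ContinuousOn (fun z => (z - W.lam i)⁻¹) (Set.range γ) :=
      (continuousOn_id.sub continuousOn_const).inv₀ h0
    have hnull := IsNull.const (γ := γ) (w := fun z => (z - W.lam i)⁻¹) fun k j =>
      contourIntegral_inv_sub_pow_eq_zero hγ hrange hout j k
    refine ⟨fun z => (z - W.lam i)⁻¹, ?_⟩
    refine forall_fin_of_succ (P := fun a => IsNull γ (fun z => (z - W.lam i)⁻¹)
      fun z => v z (W.finiteIndex i a)) (fun a ih => ?_) a
    have hnext : IsNull γ (fun z => (z - W.lam i)⁻¹) fun z =>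
        if h : (a : ℕ) + 1 < W.d i then v z (W.finiteIndex i ⟨a + 1, h⟩) else 0 := by
      split_ifs with h
      · exact ih h
      · exact hnull 0
    refine (((hnull (b₀ (W.finiteIndex i a))).add hγ hw hnext).weight_mul hw).congr
      fun z hz => ?_
    have h := congrFun (key z hz) (W.finiteIndex i a)
    rw [Pi.sub_apply, Pi.smul_apply, A_mulVec_finiteIndex, B_mulVec_finiteIndex,
      smul_eq_mul] at h
    rw [← h, eq_inv_mul_iff_mul_eq₀ (h0 z hz)]
    ring
  · have hnull := IsNull.const (γ := γ) (w := fun _ => 1) fun k j => by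
      simpa using contourIntegral_pow_eq_zero hγ k
    refine ⟨fun _ => 1, ?_⟩
    refine forall_fin_of_succ (P := fun b => IsNull γ (fun _ => 1)
      fun z => v z (W.infiniteIndex j b)) (fun b ih => ?_) b
    have hnext : IsNull γ (fun _ => 1) fun z =>
        if h : (b : ℕ) + 1 < W.e j then v z (W.infiniteIndex j ⟨b + 1, h⟩) else 0 := by
      split_ifs with h
      · exact ih h
      · exact hnull 0
    refine (hnext.id_mul.add hγ continuousOn_const (hnull (-b₀ (W.infiniteIndex j b)))).congr
      fun z hz => ?_
    have h := congrFun (key z hz) (W.infiniteIndex j b)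
    rw [Pi.sub_apply, Pi.smul_apply, A_mulVec_infiniteIndex, B_mulVec_infiniteIndex,
      smul_eq_mul] at h
    rw [← h]
    ring

theorem inv_mul_moment_apply_eq_zero (hγ : AbsolutelyContinuousOnInterval γ.extend 0 1)
    (hoff : ∀ z ∈ Set.range γ, (z • B - A).det ≠ 0) {s : ℕ}
    (hs : ∀ i a, W.lam i ∈ inside γ → (W.finiteIndex i a : ℕ) < s)
    (k : ℕ) (q c : Fin n) (hq : s ≤ q) : (W.S⁻¹ * moment A B γ k) q c = 0 := by
  have hcont : ∀ r, ContinuousOn (fun z => W.S⁻¹ q r * (z ^ k * ((z • B - A)⁻¹ * B) r c))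
      (Set.range γ) := fun r => by
    have h1 : Continuous fun M : Matrix (Fin n) (Fin n) ℂ => (M * B) r c :=
      (continuous_id.matrix_mul continuous_const).matrix_elem r c
    exact continuousOn_const.mul ((continuousOn_id.pow k).mul
      (h1.comp_continuousOn (continuousOn_pencil_inv hoff)))
  have h := W.integral_resolvent_eq_zero hγ hoff hs q c hq k
  rw [contourIntegral_congr (g := fun z => ∑ r, W.S⁻¹ q r * (z ^ k * ((z • B - A)⁻¹ * B) r c))
    fun z _ => by
      rw [Matrix.mul_apply, Finset.mul_sum]
      exact Finset.sum_congr rfl fun r _ => by ring,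
    contourIntegral_sum hγ _ _ fun r _ => hcont r] at h
  simp only [contourIntegral_const_mul] at h
  rw [Matrix.mul_apply]
  simp only [moment, of_apply, mul_left_comm (W.S⁻¹ q _)]
  rw [← Finset.mul_sum, h, mul_zero]

/-- The columns of every `F_k` lie in the span of the first `s` columns of `S`. -/
theorem colSpan_momentBlock_le (hγ : AbsolutelyContinuousOnInterval γ.extend 0 1)
    (hoff : ∀ z ∈ Set.range γ, (z • B - A).det ≠ 0) {s : ℕ}
    (hs : ∀ i a, W.lam i ∈ inside γ → (W.finiteIndex i a : ℕ) < s)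
    {h : ℕ} (Y : Matrix (Fin n) (Fin h) ℂ) (g : ℕ) :
    colSpan (momentBlock A B γ Y g) ≤ firstColSpan W.S s := by
  refine Submodule.span_le.2 ?_
  rintro _ ⟨⟨k, j⟩, rfl⟩
  refine (W.mem_firstColSpan_iff s _).2 fun q hq => ?_
  have h1 : (momentBlock A B γ Y g).col (k, j) = moment A B γ k *ᵥ Y.col j := rfl
  rw [h1, mulVec_mulVec, mulVec, dotProduct]
  exact Finset.sum_eq_zero fun c _ => by
    rw [W.inv_mul_moment_apply_eq_zero hγ hoff hs k q c hq, zero_mul]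

end WeierstrassForm

theorem finrank_firstColSpan_le {n : ℕ} (M : Matrix (Fin n) (Fin n) ℂ) (s : ℕ) :
    Module.finrank ℂ (firstColSpan M s) ≤ s := by
  classical
  have h : M.col '' {j | (j : ℕ) < s} =
      ((Finset.univ.filter fun j : Fin n => (j : ℕ) < s).image M.col : Finset _) := by
    ext; simp
  rw [firstColSpan, h]
  refine (finrank_span_finset_le_card _).trans (Finset.card_image_le.trans ?_)
  calc (Finset.univ.filter fun j : Fin n => (j : ℕ) < s).card
      ≤ (Finset.range s).card :=
        Finset.card_le_card_of_injOn Fin.val (fun j hj => by simpa using hj)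
          Fin.val_injective.injOn
    _ = s := Finset.card_range s

end ContourPencil

theorem theorem2p2 {n : ℕ} (A B : Matrix (Fin n) (Fin n) ℂ)
    (hreg : ContourPencil.IsRegularPencil A B)
    (W : ContourPencil.WeierstrassForm A B)
    {p : ℂ} (γ : Path p p)
    (hγ : ContourPencil.IsSimpleClosedCurve γ)
    (hpos : ContourPencil.IsPositivelyOriented γ)
    (hoff : ∀ z ∈ Set.range γ, (z • B - A).det ≠ 0)
    (l : ℕ) (hl : l ≤ W.m)
    (hin : ∀ i : Fin W.m, W.lam i ∈ ContourPencil.inside γ ↔ (i : ℕ) < l)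
    (s : ℕ) (hs : s = ∑ i : Fin l, W.d (Fin.castLE hl i))
    (g h : ℕ) (hg : 0 < g) (hh : 0 < h) (hgh : s ≤ h * g)
    (Y : Matrix (Fin n) (Fin h) ℂ) :
    ContourPencil.eigenvalueCount A B (ContourPencil.inside γ) = s ∧
    ContourPencil.firstColSpan W.S s =
      (⨆ μ ∈ ContourPencil.inside γ, ContourPencil.genEigenspace A B μ) ∧
    ((ContourPencil.momentBlock A B γ Y g).rank = s →
      ContourPencil.colSpan (ContourPencil.momentBlock A B γ Y g) =
        ContourPencil.firstColSpan W.S s) := by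
  obtain rfl := hs
  refine ⟨W.eigenvalueCount_eq hl hin, W.firstColSpan_eq_iSup_genEigenspace hl hin, fun hrank => ?_⟩
  refine Submodule.eq_of_le_of_finrank_le
    (W.colSpan_momentBlock_le hγ.absCont hoff
      (fun i a hi => (W.finiteIndex_lt_iff hl i a).2 ((hin i).1 hi)) Y g) ?_
  rw [ContourPencil.colSpan, ← Matrix.rank_eq_finrank_span_cols, hrank]
  exact ContourPencil.finrank_firstColSpan_le W.S _
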